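/- Let $E$ be a finite or countable set, let $\ell^2(E)$ be the real or complex Hilbert space of square-summable functions on $E$, and identify each $e\in E$ with the corresponding standard unit vector of $\ell^2(E)$. Let $H\subseteq\ell^2(E)$ be a closed linear subspace and let $P_H$ denote the orthogonal projection onto $H$. Then there is a unique probability measure $\mathbf P^H$ on the subsets of $E$ (with the product $\sigma$-algebra of $2^E$) such that, for a random set $S$ with law $\mathbf P^H$ and every finite $A\subseteq E$, $$\mathbf P^H[A\subseteq S]=\det\big[\langle P_H f, e\rangle\big]_{e,f\in A},$$ and for $\mathbf P^H$-almost every $S\subseteq E$ the closed linear span of $\{P_H e : e\in S\}$ is all of $H$: $$\overline{\operatorname{span}}\,\{P_H e : e\in S\}=H .$$ -/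

import Mathlib

open MeasureTheory

noncomputable section

/-- The Hilbert space `ℓ²(E)` of square-summable scalar functions on `E`. -/
abbrev ell2 (𝕜 E : Type*) [RCLike 𝕜] : Type _ := lp (fun _ : E => 𝕜) 2

open Classical in
/-- The standard unit vector of `ℓ²(E)` at `e`. -/
def unitVec (𝕜 : Type*) {E : Type*} [RCLike 𝕜] (e : E) : ell2 𝕜 E := lp.single 2 e 1

/-- The matrix, in the standard basis of `ℓ²(E)`, of the orthogonal projection onto `H`. -/
def projMatrix {𝕜 E : Type*} [RCLike 𝕜] (H : ClosedSubmodule 𝕜 (ell2 𝕜 E)) : Matrix E E 𝕜 :=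
  Matrix.of fun e f => inner 𝕜 (unitVec 𝕜 e) (H.toSubmodule.starProjection (unitVec 𝕜 f))

open Classical in
/-- `P` is the determinantal probability measure with kernel `Q`: a probability measure on the
product σ-algebra of `Set E` such that a `P`-random set contains a given finite set `A` with
probability the determinant of the submatrix of `Q` indexed by `A`. -/
structure IsDeterminantal {𝕜 E : Type*} [RCLike 𝕜] (Q : Matrix E E 𝕜)
    (P : Measure (Set E)) : Prop where
  isProbabilityMeasure : IsProbabilityMeasure P
  inclusion : ∀ A : Finset E,
    ((P.real {S : Set E | (A : Set E) ⊆ S} : ℝ) : 𝕜) =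
      (Q.submatrix (fun a : A => (a : E)) (fun a : A => (a : E))).det

end

/-! ### Finite determinantal linear algebra. -/

section LinearAlgebra

open Matrix
open scoped ComplexOrder

/-! On a finite window `W`, the pattern determinants are nonnegative and their sums over supersets
are the prescribed minors, so they form a law. A limit of these laws by compactness gives existence;
finite inclusion events form a generating π-system, which gives uniqueness.

For the spanning claim, it suffices that almost surely no nonzero `u ∈ H` vanishes on `S`. Fix `f ∈
H` and border each pattern matrix by the Gram data of `f`. The bordered determinants sum to `‖f‖²`,
and each is the pattern probability times `‖ellTail W g‖²`, where `g` represents `v ↦ ⟪v, f⟫` on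
vectors of `H` vanishing on the pattern, using only coordinates off `W` (`exists_tail_representer`).
So this energy has mean at most `‖f‖²` for every `W`, and by Fatou its liminf along exhausting
windows is almost surely finite. By Cauchy–Schwarz `|⟪u, f⟫|²` is at most the energy times the
squared tail norm of `u`, which tends to zero. Taking `f = P_H e` for the countably many `e` forces
`u = 0`. -/

/-- The matrix whose rows in `A` are those of `Γ` and whose other rows are those of `1 - Γ`. For a
determinantal process on a finite set with kernel `Γ`, its determinant is the probability that the
process equals `A`. -/
def patternMatrix {ι R : Type*} [DecidableEq ι] [CommRing R] (Γ : Matrix ι ι R) (A : Finset ι) :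
    Matrix ι ι R :=
  Matrix.of fun i j => if i ∈ A then Γ i j else (1 - Γ) i j

/-- Expand `det (Γ + Z)` by multilinearity in the rows. Since `Z` vanishes on `C`, only choices `A ⊇
C` survive; since `Γ + Z` has identity rows off `C`, its determinant is the minor on `C`. -/
theorem sum_det_patternMatrix {ι R : Type*} [Fintype ι] [DecidableEq ι] [CommRing R]
    (Γ : Matrix ι ι R) (C : Finset ι) :
    ∑ A : Finset ι with C ⊆ A, (patternMatrix Γ A).det =
      (Γ.submatrix (fun c : C => (c : ι)) (fun c : C => (c : ι))).det := by
  let Z : Matrix ι ι R := of fun i j => if i ∈ C then 0 else (1 - Γ) i j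
  have h := (detRowAlternating : (ι → R) [⋀^ι]→ₗ[R] R).map_add_univ Γ Z
  rw [Finset.sum_filter]
  have hR : (Γ + Z).det =
      (Γ.submatrix (fun c : C => (c : ι)) (fun c : C => (c : ι))).det := by
    rw [Matrix.twoBlockTriangular_det _ (fun i => i ∈ C)]
    · have h1 : Matrix.toSquareBlockProp (Γ + Z)
          (fun i => ¬ i ∈ C) = 1 := by
        ext ⟨i, hi⟩ ⟨j, hj⟩
        simp [Z, Matrix.toSquareBlockProp, hi, Matrix.one_apply]
      have h2 : Matrix.toSquareBlockProp (Γ + Z)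
          (fun i => i ∈ C) = Γ.submatrix (fun c : C => (c : ι)) (fun c : C => (c : ι)) := by
        ext ⟨i, hi⟩ ⟨j, hj⟩
        simp [Z, Matrix.toSquareBlockProp, hi]
      rw [h1, h2, det_one, mul_one]
      congr!
    · intro i hi j hj
      have : i ≠ j := fun h => hi (h ▸ hj)
      simp [Z, hi, this]
  rw [← hR]
  refine Eq.trans (Finset.sum_congr rfl fun A _ => ?_) h.symm
  have hrow : ∀ i j, (A.piecewise Γ Z : Matrix ι ι R) i j = if i ∈ A then Γ i j else Z i j := by
    intro i j
    by_cases hi : i ∈ A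
    · rw [Finset.piecewise_eq_of_mem A Γ Z hi, if_pos hi]
    · rw [Finset.piecewise_eq_of_notMem A Γ Z hi, if_neg hi]
  split_ifs with hCA
  · refine congrArg Matrix.det (Matrix.ext fun i j => ?_)
    rw [hrow]
    by_cases hi : i ∈ A
    · simp [patternMatrix, hi]
    · have : i ∉ C := fun h => hi (hCA h)
      simp [patternMatrix, Z, hi, this]
  · obtain ⟨i, hiC, hiA⟩ := Finset.not_subset.1 hCA
    refine (Matrix.det_eq_zero_of_row_eq_zero (A := Matrix.of (A.piecewise Γ Z)) i
      (fun j => ?_)).symm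
    rw [of_apply, hrow]
    simp [Z, hiC, hiA]

variable {𝕜 : Type*} [RCLike 𝕜]

theorem det_patternMatrix_eq_fromBlocks {ι : Type*} [Fintype ι] [DecidableEq ι]
    (Γ : Matrix ι ι 𝕜) (A : Finset ι) :
    (patternMatrix Γ A).det =
      (fromBlocks (Γ.toBlock (· ∈ A) (· ∈ A)) (Γ.toBlock (· ∈ A) (· ∉ A))
        (-Γ.toBlock (· ∉ A) (· ∈ A)) (1 - Γ.toBlock (· ∉ A) (· ∉ A))).det := by
  rw [Matrix.det_toBlock _ (· ∈ A)]
  have h11 : (patternMatrix Γ A).toBlock (· ∈ A) (· ∈ A) = Γ.toBlock (· ∈ A) (· ∈ A) := by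
    ext i j
    simp [patternMatrix, i.2]
  have h12 : (patternMatrix Γ A).toBlock (· ∈ A) (· ∉ A) = Γ.toBlock (· ∈ A) (· ∉ A) := by
    ext i j
    simp [patternMatrix, i.2]
  have h21 : (patternMatrix Γ A).toBlock (· ∉ A) (· ∈ A) = -Γ.toBlock (· ∉ A) (· ∈ A) := by
    ext i j
    have : i.1 ≠ j.1 := fun h => i.2 (h ▸ j.2)
    simp [patternMatrix, i.2, this]
  have h22 : (patternMatrix Γ A).toBlock (· ∉ A) (· ∉ A) = 1 - Γ.toBlock (· ∉ A) (· ∉ A) := by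
    ext i j
    simp [patternMatrix, i.2, Matrix.one_apply, Subtype.ext_iff]
  rw [h11, h12, h21, h22]
  congr!

/-- The sign in the lower left block turns the Schur complement into a sum of two positive
semidefinite matrices. -/
theorem det_patternMatrix_nonneg_of_posDef {ι : Type*} [Fintype ι] [DecidableEq ι]
    {Γ : Matrix ι ι 𝕜} (hΓ : Γ.PosSemidef) (A : Finset ι)
    (hA : (1 - Γ.toBlock (· ∉ A) (· ∉ A)).PosDef) :
    0 ≤ (patternMatrix Γ A).det := by
  rw [det_patternMatrix_eq_fromBlocks]
  have : Invertible (1 - Γ.toBlock (· ∉ A) (· ∉ A)) := hA.isUnit.invertible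
  rw [Matrix.det_fromBlocks₂₂, invOf_eq_nonsing_inv]
  refine mul_nonneg hA.det_pos.le (PosSemidef.det_nonneg ?_)
  have h1 : (Γ.toBlock (· ∈ A) (· ∈ A)).PosSemidef := hΓ.submatrix _
  have h2 := hA.inv.posSemidef.mul_mul_conjTranspose_same (Γ.toBlock (· ∈ A) (· ∉ A))
  have h3 : (Γ.toBlock (· ∈ A) (· ∉ A))ᴴ = Γ.toBlock (· ∉ A) (· ∈ A) := by
    ext i j
    exact hΓ.1.apply _ _
  rw [h3] at h2
  simpa using h1.add h2

/-- Scale `Γ` by `t < 1` to reach the definite case, then let `t → 1`. Contractivity is required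
only off `A`, which admits a bordering vector of arbitrary norm. -/
theorem det_patternMatrix_nonneg {ι : Type*} [Fintype ι] [DecidableEq ι]
    {Γ : Matrix ι ι 𝕜} (hΓ : Γ.PosSemidef) (A : Finset ι)
    (hA : (1 - Γ.toBlock (· ∉ A) (· ∉ A)).PosSemidef) :
    0 ≤ (patternMatrix Γ A).det := by
  have hcont : Continuous fun t : ℝ => (patternMatrix (t • Γ) A).det := by
    refine Continuous.matrix_det ?_
    refine continuous_matrix fun i j => ?_
    by_cases hi : i ∈ A
    · simp only [patternMatrix, of_apply, hi, if_true, Matrix.smul_apply]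
      fun_prop
    · simp only [patternMatrix, of_apply, hi, if_false, Matrix.sub_apply, Matrix.smul_apply]
      fun_prop
  have hlim : Filter.Tendsto (fun t : ℝ => (patternMatrix (t • Γ) A).det)
      (nhdsWithin 1 (Set.Ioo 0 1)) (nhds (patternMatrix Γ A).det) := by
    have := (hcont.tendsto 1).mono_left (nhdsWithin_le_nhds (s := Set.Ioo 0 1))
    simpa using this
  have : (nhdsWithin (1 : ℝ) (Set.Ioo 0 1)).NeBot := by
    rw [nhdsWithin_Ioo_eq_nhdsLT one_pos]; infer_instance
  refine ge_of_tendsto hlim (eventually_nhdsWithin_of_forall fun t ht => ?_)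
  have ht0 : (0 : 𝕜) ≤ (t : 𝕜) := by exact_mod_cast ht.1.le
  have hsm : t • Γ = (t : 𝕜) • Γ := by ext; simp [RCLike.real_smul_eq_coe_mul]
  refine det_patternMatrix_nonneg_of_posDef (hsm ▸ hΓ.smul ht0) A ?_
  have hpos : ((((1 - t : ℝ)) : 𝕜) • (1 : Matrix {i // i ∉ A} {i // i ∉ A} 𝕜)).PosDef :=
    PosDef.one.smul (by exact_mod_cast sub_pos.2 ht.2)
  have : 1 - (t • Γ).toBlock (· ∉ A) (· ∉ A) =
      (((1 - t : ℝ)) : 𝕜) • 1 + (t : 𝕜) • (1 - Γ.toBlock (· ∉ A) (· ∉ A)) := by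
    ext i j
    simp [toBlock, RCLike.real_smul_eq_coe_mul]
    ring
  rw [this]
  exact hpos.add_posSemidef (hA.smul ht0)

/-- Möbius inversion by downward induction; it recovers pattern probabilities from inclusion
probabilities. -/
theorem eq_of_sum_superset_eq {ι M : Type*} [Fintype ι] [DecidableEq ι] [AddCommGroup M]
    {f g : Finset ι → M} (h : ∀ C, ∑ A : Finset ι with C ⊆ A, f A = ∑ A : Finset ι with C ⊆ A, g A)
    (C : Finset ι) : f C = g C := by
  induction C using WellFoundedGT.induction with
  | ind C ih =>
    have key : ∀ k : Finset ι → M, ∑ A : Finset ι with C ⊆ A, k A =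
        k C + ∑ A : Finset ι with C ⊂ A, k A := by
      intro k
      rw [← Finset.sum_insert (by simp)]
      congr 1
      ext A
      simp [subset_iff_ssubset_or_eq, or_comm, eq_comm]
    have h2 : ∑ A : Finset ι with C ⊂ A, f A = ∑ A : Finset ι with C ⊂ A, g A :=
      Finset.sum_congr rfl fun A hA => ih A (Finset.mem_filter.1 hA).2
    have h1 := h C
    rw [key, key, h2] at h1
    exact add_right_cancel h1

end LinearAlgebra

/-! ### Existence and uniqueness of the determinantal measure. -/

section Measure

open Matrix
open scoped ComplexOrder

theorem generateFrom_range_setOf_subset {E : Type*} :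
    (Set.instMeasurableSpace : MeasurableSpace (Set E)) =
      MeasurableSpace.generateFrom (Set.range fun A : Finset E => {S : Set E | (A : Set E) ⊆ S}) := by
  apply le_antisymm
  · have h : @Measurable (Set E) (Set E) (MeasurableSpace.generateFrom
        (Set.range fun A : Finset E => {S : Set E | (A : Set E) ⊆ S})) _ id := by
      refine @measurable_set_iff _ _ (_) _ |>.2 fun a => ?_
      refine @measurableSet_setOfPred _ (_) _ |>.1 ?_
      exact MeasurableSpace.measurableSet_generateFrom ⟨{a}, by ext; simp⟩
    simpa using measurable_iff_comap_le.1 h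
  · refine MeasurableSpace.generateFrom_le ?_
    rintro _ ⟨A, rfl⟩
    have : {S : Set E | (A : Set E) ⊆ S} = ⋂ a ∈ A, {S | a ∈ S} := by
      ext S
      simp [Set.subset_def]
    simp only [this]
    exact Finset.measurableSet_biInter _ fun a _ => measurableSet_mem a

theorem measurableSet_setOf_coe_subset {E : Type*} (A : Finset E) :
    MeasurableSet {S : Set E | (A : Set E) ⊆ S} := by
  rw [generateFrom_range_setOf_subset]
  exact MeasurableSpace.measurableSet_generateFrom ⟨A, rfl⟩

variable {𝕜 E : Type*} [RCLike 𝕜]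

theorem IsDeterminantal.unique {Q : Matrix E E 𝕜} {P P' : Measure (Set E)}
    (h : IsDeterminantal Q P) (h' : IsDeterminantal Q P') : P = P' := by
  classical
  have := h.isProbabilityMeasure
  have := h'.isProbabilityMeasure
  refine ext_of_generate_finite _ generateFrom_range_setOf_subset ?_ ?_ (by simp)
  · rintro _ ⟨A, rfl⟩ _ ⟨B, rfl⟩ -
    exact ⟨A ∪ B, by ext S; simp⟩
  · rintro _ ⟨A, rfl⟩
    have := (h.inclusion A).trans (h'.inclusion A).symm
    rw [← measureReal_eq_measureReal_iff]
    exact_mod_cast this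

open Classical in
theorem det_submatrix_map_subtype (Q : Matrix E E 𝕜) {W : Finset E} (C : Finset W) :
    (Q.submatrix (fun a : C.map (Function.Embedding.subtype (· ∈ W)) => (a : E))
      (fun a : C.map (Function.Embedding.subtype (· ∈ W)) => (a : E))).det =
    ((Q.submatrix (fun a : W => (a : E)) (fun a : W => (a : E))).submatrix
      (fun c : C => (c : W)) (fun c : C => (c : W))).det := by
  rw [← det_submatrix_equiv_self (Equiv.ofBijective
    (fun c : C => (⟨c, Finset.mem_map_of_mem _ c.2⟩ :
      C.map (Function.Embedding.subtype (· ∈ W)))) ⟨fun a b h => ?_, fun ⟨a, ha⟩ => ?_⟩)]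
  · rfl
  · have h' : ((a : W) : E) = b := congrArg (fun z => z.1) h
    exact Subtype.ext (Subtype.ext h')
  · obtain ⟨c, hc, rfl⟩ := Finset.mem_map.1 ha
    exact ⟨⟨c, hc⟩, rfl⟩

open Classical in
/-- A probability measure on `E → Bool` with the inclusion probabilities prescribed by `Q` for
subsets of the finite set `W`. -/
theorem exists_probabilityMeasure_inclusion (Q : Matrix E E 𝕜) (W : Finset E)
    (hQ : ∀ A : Finset W,
      0 ≤ (patternMatrix (Q.submatrix (fun a : W => (a : E)) (fun a : W => (a : E))) A).det) :
    ∃ μ : ProbabilityMeasure (E → Bool), ∀ C ⊆ W,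
      (((μ : Measure (E → Bool)).real {x | ∀ c ∈ C, x c = true} : ℝ) : 𝕜) =
        (Q.submatrix (fun a : C => (a : E)) (fun a : C => (a : E))).det := by
  set Γ := Q.submatrix (fun a : W => (a : E)) (fun a : W => (a : E)) with hΓ
  let p : Finset W → ℝ := fun A => RCLike.re (patternMatrix Γ A).det
  have hp0 : ∀ A, 0 ≤ p A := fun A => (RCLike.nonneg_iff.1 (hQ A)).1
  have hp : ∀ A, ((p A : ℝ) : 𝕜) = (patternMatrix Γ A).det := fun A =>
    RCLike.conj_eq_iff_re.1 (RCLike.conj_eq_iff_im.2 (RCLike.nonneg_iff.1 (hQ A)).2)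
  -- Points outside `W` are never selected; only the marginal on `W` matters.
  let x : Finset W → E → Bool := fun A e => decide (∃ h : e ∈ W, (⟨e, h⟩ : W) ∈ A)
  let μ : Measure (E → Bool) := ∑ A, ENNReal.ofReal (p A) • Measure.dirac (x A)
  have hmeas : ∀ C : Finset E, MeasurableSet {x : E → Bool | ∀ c ∈ C, x c = true} := by
    intro C
    have : {x : E → Bool | ∀ c ∈ C, x c = true} = ⋂ c ∈ C, (fun x => x c) ⁻¹' {true} := by
      ext; simp
    rw [this]
    exact Finset.measurableSet_biInter _ fun c _ => measurable_pi_apply c (measurableSet_singleton _)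
  have hμ : ∀ C : Finset W, μ {x | ∀ c ∈ C.map (Function.Embedding.subtype (· ∈ W)), x c = true} =
      ENNReal.ofReal (∑ A with C ⊆ A, p A) := by
    intro C
    rw [ENNReal.ofReal_sum_of_nonneg fun A _ => hp0 A, Finset.sum_filter]
    simp only [μ, Measure.coe_finsetSum, Finset.sum_apply, Measure.smul_apply, smul_eq_mul]
    refine Finset.sum_congr rfl fun A _ => ?_
    rw [Measure.dirac_apply' _ (hmeas _)]
    have : x A ∈ {x : E → Bool | ∀ c ∈ C.map (Function.Embedding.subtype (· ∈ W)), x c = true} ↔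
        C ⊆ A := by
      simp only [x, Set.mem_ofPred_eq, Finset.mem_map, decide_eq_true_eq]
      constructor
      · intro h c hc
        exact (h c ⟨c, hc, rfl⟩).2
      · rintro h _ ⟨c, hc, rfl⟩
        exact ⟨c.2, h hc⟩
    by_cases hCA : C ⊆ A
    · rw [Set.indicator_of_mem (this.2 hCA), if_pos hCA]; simp
    · rw [Set.indicator_of_notMem (mt this.1 hCA), if_neg hCA]; simp
  have hreal : ∀ C : Finset W,
      ((μ.real {x | ∀ c ∈ C.map (Function.Embedding.subtype (· ∈ W)), x c = true} : ℝ) : 𝕜) =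
        (Q.submatrix (fun a : C.map (Function.Embedding.subtype (· ∈ W)) => (a : E))
          (fun a : C.map (Function.Embedding.subtype (· ∈ W)) => (a : E))).det := by
    intro C
    rw [det_submatrix_map_subtype, ← hΓ, Measure.real, hμ,
      ENNReal.toReal_ofReal (Finset.sum_nonneg fun A _ => hp0 A), RCLike.ofReal_sum]
    simp only [hp]
    convert sum_det_patternMatrix Γ C
  have huniv : μ Set.univ = 1 := by
    have h := hreal ∅
    have : μ.real Set.univ = 1 := by
      have h2 : ((μ.real Set.univ : ℝ) : 𝕜) = ((1 : ℝ) : 𝕜) := by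
        rw [det_submatrix_map_subtype, det_isEmpty] at h
        simpa only [Finset.map_empty, Finset.notMem_empty, false_imp_iff, implies_true,
          Set.ofPred_true, RCLike.ofReal_one] using h
      exact RCLike.ofReal_injective h2
    exact (ENNReal.toReal_eq_one_iff _).1 this
  refine ⟨⟨μ, ⟨huniv⟩⟩, fun C hC => ?_⟩
  have h := hreal (C.subtype (· ∈ W))
  rwa [Finset.subtype_map_of_mem fun x hx => hC hx] at h

open Classical in
theorem exists_isDeterminantal [Countable E] (Q : Matrix E E 𝕜)
    (hQ : ∀ (W : Finset E) (A : Finset W),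
      0 ≤ (patternMatrix (Q.submatrix (fun a : W => (a : E)) (fun a : W => (a : E))) A).det) :
    ∃ P : Measure (Set E), IsDeterminantal Q P := by
  choose μ hμ using fun W => exists_probabilityMeasure_inclusion Q W (hQ W)
  -- Along an ultrafilter finer than `atTop` the window laws converge by compactness. Inclusion
  -- events are clopen, so their probabilities pass to the limit, and they are constant once `A ⊆
  -- W`.
  let U : Ultrafilter (Finset E) := Ultrafilter.of Filter.atTop
  obtain ⟨ν, -, hν⟩ := isCompact_univ.ultrafilter_le_nhds (U.map μ) (by simp)
  have hlim : Filter.Tendsto μ U (nhds ν) := hν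
  let toSet : (E → Bool) → Set E := fun x => {e | x e = true}
  have htoSet : Measurable toSet := by
    refine measurable_set_iff.2 fun a => measurableSet_setOfPred.1 ?_
    exact (measurable_pi_apply a : Measurable fun x : E → Bool => x a)
      (measurableSet_singleton true)
  refine ⟨(ν : Measure (E → Bool)).map toSet,
    Measure.isProbabilityMeasure_map htoSet.aemeasurable, fun A => ?_⟩
  have hpre : toSet ⁻¹' {S : Set E | (A : Set E) ⊆ S} = {x | ∀ c ∈ A, x c = true} := by
    ext x
    simp [toSet, Set.subset_def]
  rw [map_measureReal_apply htoSet (measurableSet_setOf_coe_subset A), hpre]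
  have hclopen : IsClopen {x : E → Bool | ∀ c ∈ A, x c = true} := by
    have : {x : E → Bool | ∀ c ∈ A, x c = true} = ⋂ c ∈ A, (fun x => x c) ⁻¹' {true} := by
      ext; simp
    rw [this]
    exact A.finite_toSet.isClopen_biInter fun c _ =>
      (isClopen_discrete {true}).preimage (continuous_apply c)
  have hconv := ProbabilityMeasure.tendsto_measure_of_null_frontier_of_tendsto' hlim
    (E := {x : E → Bool | ∀ c ∈ A, x c = true}) (by rw [hclopen.frontier_eq]; simp)
  have hconv' := (RCLike.continuous_ofReal (K := 𝕜)).continuousAt.tendsto.comp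
    ((ENNReal.tendsto_toReal (measure_ne_top _ _)).comp hconv)
  refine tendsto_nhds_unique_of_eventuallyEq hconv' tendsto_const_nhds ?_
  have : ∀ᶠ W in Filter.atTop, A ⊆ W := Filter.eventually_ge_atTop A
  filter_upwards [Ultrafilter.of_le _ this] with W hW
  exact hμ W A hW

end Measure

/-! ### Gram matrices, bordered determinants and tails in `ℓ²(E)`. -/

section Hilbert

open Matrix Filter
open scoped ComplexOrder

variable {𝕜 E : Type*} [RCLike 𝕜]

theorem inner_unitVec_left (e : E) (v : ell2 𝕜 E) : inner 𝕜 (unitVec 𝕜 e) v = v e := by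
  classical
  rw [unitVec, lp.inner_single_left]
  simp

theorem inner_unitVec_right (e : E) (v : ell2 𝕜 E) :
    inner 𝕜 v (unitVec 𝕜 e) = starRingEnd 𝕜 (v e) := by
  rw [← inner_conj_symm, inner_unitVec_left]

theorem inner_starProjection_unitVec_left {H : ClosedSubmodule 𝕜 (ell2 𝕜 E)} {v : ell2 𝕜 E}
    (hv : v ∈ H.toSubmodule) (e : E) :
    inner 𝕜 (H.toSubmodule.starProjection (unitVec 𝕜 e)) v = v e := by
  rw [Submodule.inner_starProjection_left_eq_right, Submodule.starProjection_eq_self_iff.2 hv,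
    inner_unitVec_left]

theorem inner_starProjection_unitVec_right {H : ClosedSubmodule 𝕜 (ell2 𝕜 E)} {v : ell2 𝕜 E}
    (hv : v ∈ H.toSubmodule) (e : E) :
    inner 𝕜 v (H.toSubmodule.starProjection (unitVec 𝕜 e)) = starRingEnd 𝕜 (v e) := by
  rw [← inner_conj_symm, inner_starProjection_unitVec_left hv]

theorem inner_starProjection_starProjection (H : ClosedSubmodule 𝕜 (ell2 𝕜 E)) (u v : ell2 𝕜 E) :
    inner 𝕜 (H.toSubmodule.starProjection u) (H.toSubmodule.starProjection v) =
      inner 𝕜 u (H.toSubmodule.starProjection v) := by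
  rw [Submodule.inner_starProjection_left_eq_right, Submodule.starProjection_eq_self_iff.2
    (Submodule.starProjection_apply_mem _ _)]

/-- The part of `v` supported off the finite set `W`. -/
noncomputable def ellTail (W : Finset E) (v : ell2 𝕜 E) : ell2 𝕜 E := v - ∑ w : W, v w • unitVec 𝕜 (w : E)

open Classical in
theorem unitVec_apply (e e' : E) : unitVec 𝕜 e e' = if e = e' then 1 else 0 := by
  rw [← inner_unitVec_left, inner_unitVec_right, unitVec, lp.single_apply]
  by_cases h : e = e'
  · subst h; simp
  · simp [h]

theorem ellTail_apply_of_mem {W : Finset E} {w : E} (hw : w ∈ W) (v : ell2 𝕜 E) :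
    ellTail W v w = 0 := by
  classical
  have h : (∑ w : W, v w • unitVec 𝕜 (w : E)) w = v w := by
    rw [lp.coeFn_sum, Finset.sum_apply, Finset.sum_eq_single (⟨w, hw⟩ : W)]
    · simp [unitVec_apply]
    · intro b _ hb
      have : (b : E) ≠ w := fun h => hb (Subtype.ext h)
      simp [unitVec_apply, this]
    · simp
  rw [ellTail, lp.coeFn_sub, Pi.sub_apply, h, sub_self]

theorem inner_ellTail_ellTail (W : Finset E) (v g : ell2 𝕜 E) :
    inner 𝕜 (ellTail W v) (ellTail W g) =
      inner 𝕜 v g - ∑ w : W, starRingEnd 𝕜 (v w) * g w := by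
  have h : inner 𝕜 (ellTail W v) (ellTail W g) = inner 𝕜 v (ellTail W g) := by
    conv_lhs => rw [ellTail, inner_sub_left, sum_inner]
    rw [Finset.sum_eq_zero fun w _ => ?_, sub_zero]
    rw [inner_smul_left, inner_unitVec_left, ellTail_apply_of_mem w.2, mul_zero]
  rw [h, ellTail, inner_sub_right, inner_sum]
  congr 1
  refine Finset.sum_congr rfl fun w _ => ?_
  rw [inner_smul_right, inner_unitVec_right, mul_comm]

theorem tendsto_norm_ellTail (v : ell2 𝕜 E) :
    Tendsto (fun W : Finset E => ‖ellTail W v‖) atTop (nhds 0) := by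
  classical
  have h : Tendsto (fun W : Finset E => ∑ w ∈ W, v w • unitVec 𝕜 w) atTop (nhds v) := by
    refine (lp.hasSum_single (p := 2) (by simp) v).congr fun W => ?_
    refine Finset.sum_congr rfl fun w _ => ?_
    simp only [unitVec]
    rw [← lp.single_smul, smul_eq_mul, mul_one]
  have h2 := (tendsto_const_nhds (x := v)).sub h
  rw [sub_self] at h2
  refine (tendsto_norm_zero.comp h2).congr fun W => ?_
  simp only [Function.comp, ellTail]
  rw [Finset.sum_coe_sort W (fun w => v w • unitVec 𝕜 w)]

/-- The Gram matrix of `f` and the projections to `H` of the unit vectors indexed by `W`. -/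
noncomputable def extGram (H : ClosedSubmodule 𝕜 (ell2 𝕜 E)) (f : ell2 𝕜 E) (W : Finset E) :
    Matrix (Unit ⊕ W) (Unit ⊕ W) 𝕜 :=
  Matrix.gram 𝕜 (Sum.elim (fun _ => f)
    (fun w : W => H.toSubmodule.starProjection (unitVec 𝕜 (w : E))))

open Classical in
/-- The determinant for the pattern `A` on `W`, bordered by the vector `f`. -/
noncomputable def borderedDet (H : ClosedSubmodule 𝕜 (ell2 𝕜 E)) (f : ell2 𝕜 E) (W : Finset E)
    (A : Finset W) : 𝕜 :=
  (patternMatrix (extGram H f W) (Finset.univ.disjSum A)).det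

open Classical in
/-- The determinant giving the probability that the process equals `A` on `W`. -/
noncomputable def patternDet (H : ClosedSubmodule 𝕜 (ell2 𝕜 E)) (W : Finset E) (A : Finset W) : 𝕜 :=
  (patternMatrix ((projMatrix H).submatrix (fun a : W => (a : E)) (fun a : W => (a : E))) A).det

theorem one_sub_projMatrix_submatrix_posSemidef {ι : Type*} [Fintype ι] [DecidableEq ι]
    (H : ClosedSubmodule 𝕜 (ell2 𝕜 E)) {k : ι → E} (hk : Function.Injective k) :
    (1 - (projMatrix H).submatrix k k).PosSemidef := by
  classical
  have : 1 - (projMatrix H).submatrix k k = Matrix.gram 𝕜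
      (fun i => unitVec 𝕜 (k i) - H.toSubmodule.starProjection (unitVec 𝕜 (k i))) := by
    ext i j
    simp only [Matrix.gram_apply, projMatrix, Matrix.sub_apply, submatrix_apply, of_apply,
      inner_sub_left, inner_sub_right, inner_starProjection_starProjection,
      Submodule.inner_starProjection_left_eq_right H.toSubmodule (unitVec 𝕜 (k i)) (unitVec 𝕜 (k j)),
      sub_self, sub_zero]
    rw [inner_unitVec_left (k i) (unitVec 𝕜 (k j)), unitVec_apply, Matrix.one_apply]
    simp [hk.eq_iff, eq_comm]
  rw [this]
  exact Matrix.posSemidef_gram _ _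

theorem projMatrix_submatrix_posSemidef {ι : Type*} [Fintype ι]
    (H : ClosedSubmodule 𝕜 (ell2 𝕜 E)) (k : ι → E) :
    ((projMatrix H).submatrix k k).PosSemidef := by
  have : (projMatrix H).submatrix k k = Matrix.gram 𝕜
      (fun i => H.toSubmodule.starProjection (unitVec 𝕜 (k i))) := by
    ext i j
    simp [Matrix.gram_apply, projMatrix, inner_starProjection_starProjection]
  rw [this]
  exact Matrix.posSemidef_gram _ _

theorem patternDet_nonneg (H : ClosedSubmodule 𝕜 (ell2 𝕜 E)) (W : Finset E) (A : Finset W) :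
    0 ≤ patternDet H W A := by
  classical
  refine det_patternMatrix_nonneg (projMatrix_submatrix_posSemidef H _) A ?_
  have := one_sub_projMatrix_submatrix_posSemidef H
    (k := fun i : {i : W // i ∉ A} => ((i : W) : E))
    (Subtype.val_injective.comp Subtype.val_injective)
  convert this using 2
  rfl

/-- The index of `f` always belongs to the pattern, so the complementary block involves only the
projection kernel. -/
theorem borderedDet_nonneg (H : ClosedSubmodule 𝕜 (ell2 𝕜 E)) (f : ell2 𝕜 E) (W : Finset E)
    (A : Finset W) : 0 ≤ borderedDet H f W A := by
  classical
  refine det_patternMatrix_nonneg (Matrix.posSemidef_gram _ _) _ ?_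
  have hmem : ∀ i : {i : Unit ⊕ W // i ∉ (Finset.univ : Finset Unit).disjSum A},
      ∃ w : W, i.1 = Sum.inr w := by
    rintro ⟨i | w, hi⟩
    · exact absurd (Finset.inl_mem_disjSum.2 (Finset.mem_univ i)) hi
    · exact ⟨w, rfl⟩
  choose k hk using hmem
  have hinj : Function.Injective fun i => (k i : E) := by
    intro i j hij
    have : k i = k j := Subtype.ext hij
    exact Subtype.ext (by rw [hk, hk, this])
  have := one_sub_projMatrix_submatrix_posSemidef H hinj
  convert this using 1
  congr 1
  ext i j
  simp [Matrix.gram_apply, hk, projMatrix, inner_starProjection_starProjection]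

theorem sum_borderedDet (H : ClosedSubmodule 𝕜 (ell2 𝕜 E)) (f : ell2 𝕜 E) (W : Finset E) :
    ∑ A : Finset W, borderedDet H f W A = ((‖f‖ ^ 2 : ℝ) : 𝕜) := by
  classical
  have h := sum_det_patternMatrix (extGram H f W) {Sum.inl ()}
  have hdet : ((extGram H f W).submatrix
      (fun c : ({Sum.inl ()} : Finset (Unit ⊕ W)) => (c : Unit ⊕ W))
      (fun c : ({Sum.inl ()} : Finset (Unit ⊕ W)) => (c : Unit ⊕ W))).det =
        ((‖f‖ ^ 2 : ℝ) : 𝕜) := by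
    rw [Matrix.det_unique]
    simp [extGram, Matrix.gram_apply, inner_self_eq_norm_sq_to_K]
  rw [hdet] at h
  rw [← h]
  refine Finset.sum_bij' (fun A _ => (Finset.univ : Finset Unit).disjSum A)
    (fun B _ => B.toRight) ?_ ?_ ?_ ?_ ?_
  · intro A _; simp
  · intro A _; simp
  · intro A _; simp
  · intro B hB
    have hB' : Sum.inl () ∈ B := by simpa using hB
    ext (u | w)
    · simp [hB']
    · simp
  · intro A _
    rfl

open Classical in
theorem patternMatrix_extGram_eq_fromBlocks (H : ClosedSubmodule 𝕜 (ell2 𝕜 E)) {f : ell2 𝕜 E}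
    (hf : f ∈ H.toSubmodule) (W : Finset E) (A : Finset W) :
    patternMatrix (extGram H f W) (Finset.univ.disjSum A) =
      fromBlocks (of fun _ _ => inner 𝕜 f f) (of fun _ (w : W) => starRingEnd 𝕜 (f (w : E)))
        (of fun w _ => if w ∈ A then f (w : E) else -f (w : E))
        (patternMatrix
          ((projMatrix H).submatrix (fun a : W => (a : E)) (fun a : W => (a : E))) A) := by
  ext (u | w) (u' | w')
  · simp [patternMatrix, extGram, Matrix.gram_apply]
  · simp [patternMatrix, extGram, Matrix.gram_apply, inner_starProjection_unitVec_right hf]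
  · by_cases hw : w ∈ A
    · simp [patternMatrix, extGram, Matrix.gram_apply, inner_starProjection_unitVec_left hf, hw]
    · simp [patternMatrix, extGram, Matrix.gram_apply, inner_starProjection_unitVec_left hf, hw]
  · by_cases hw : w ∈ A
    · simp [patternMatrix, extGram, Matrix.gram_apply, hw, projMatrix,
        inner_starProjection_starProjection]
    · simp [patternMatrix, extGram, Matrix.gram_apply, hw, projMatrix,
        inner_starProjection_starProjection, Matrix.one_apply]

/-- The Schur complement of the border is `⟪f, g⟫`, where `g` corrects `f` by projected unit vectors
with coefficients solving `M c = col`. -/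
theorem exists_tail_representer (H : ClosedSubmodule 𝕜 (ell2 𝕜 E)) {f : ell2 𝕜 E}
    (hf : f ∈ H.toSubmodule) (W : Finset E) (A : Finset W) (hA : patternDet H W A ≠ 0) :
    ∃ g : ell2 𝕜 E, borderedDet H f W A = patternDet H W A * ((‖ellTail W g‖ ^ 2 : ℝ) : 𝕜) ∧
      ∀ v ∈ H.toSubmodule, (∀ a ∈ A, v (a : E) = 0) →
        inner 𝕜 v f = inner 𝕜 (ellTail W v) (ellTail W g) := by
  classical
  set M := patternMatrix
    ((projMatrix H).submatrix (fun a : W => (a : E)) (fun a : W => (a : E))) A with hM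
  have hdetM : patternDet H W A = M.det := by rw [patternDet]
  let col : Matrix W Unit 𝕜 := of fun w _ => if w ∈ A then f (w : E) else -f (w : E)
  have : Invertible M := M.invertibleOfIsUnitDet (isUnit_iff_ne_zero.2 (hdetM ▸ hA))
  let c : W → 𝕜 := fun w => (⅟M * col) w ()
  have hMc : ∀ w, ∑ w', M w w' * c w' = col w () := by
    intro w
    have : (M * (⅟M * col)) w () = col w () := by rw [Matrix.mul_invOf_cancel_left]
    rw [← this, Matrix.mul_apply]
  let x : W → ell2 𝕜 E := fun w => H.toSubmodule.starProjection (unitVec 𝕜 (w : E))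
  have hx : ∀ w, x w ∈ H.toSubmodule := fun w => Submodule.starProjection_apply_mem _ _
  let g : ell2 𝕜 E := f - ∑ w, c w • x w
  have hg : g ∈ H.toSubmodule :=
    sub_mem hf (Submodule.sum_mem _ fun w _ => Submodule.smul_mem _ _ (hx w))
  have hgw : ∀ w : W, g w = f w - ∑ w' : W, projMatrix H w w' * c w' := by
    intro w
    rw [← inner_unitVec_left, inner_sub_right, inner_sum, inner_unitVec_left]
    congr 1
    refine Finset.sum_congr rfl fun w' _ => ?_
    rw [inner_smul_right, mul_comm]
    rfl
  -- The rows of `M c = col` in `A` make `g` vanish there; the others give `c w = -g w`, which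
  -- cancels the window part of `⟪v, g⟫`.
  have hgA : ∀ w ∈ A, g (w : E) = 0 := by
    intro w hw
    have := hMc w
    simp only [hM, patternMatrix, of_apply, hw, if_true, submatrix_apply, col] at this
    rw [hgw, this, sub_self]
  have hgB : ∀ w ∉ A, c w = -g (w : E) := by
    intro w hw
    have := hMc w
    simp only [hM, patternMatrix, of_apply, hw, if_false, submatrix_apply, Matrix.sub_apply,
      sub_mul, Finset.sum_sub_distrib, col, Matrix.one_apply, ite_mul, one_mul, zero_mul,
      Finset.sum_ite_eq, Finset.mem_univ, if_true] at this
    rw [hgw]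
    linear_combination this
  have hrep : ∀ v ∈ H.toSubmodule, (∀ a ∈ A, v (a : E) = 0) →
      inner 𝕜 v f = inner 𝕜 (ellTail W v) (ellTail W g) := by
    intro v hv hvA
    rw [inner_ellTail_ellTail, eq_sub_iff_add_eq]
    have h1 : inner 𝕜 v g = inner 𝕜 v f - ∑ w, c w * starRingEnd 𝕜 (v (w : E)) := by
      rw [inner_sub_right, inner_sum]
      congr 1
      refine Finset.sum_congr rfl fun w _ => ?_
      rw [inner_smul_right, inner_starProjection_unitVec_right hv]
    rw [h1, sub_eq_add_neg, ← Finset.sum_neg_distrib]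
    congr 1
    refine Finset.sum_congr rfl fun w _ => ?_
    by_cases hw : w ∈ A
    · simp [hvA w hw]
    · rw [hgB w hw]; ring
  refine ⟨g, ?_, hrep⟩
  have hself : inner 𝕜 f g = ((‖ellTail W g‖ ^ 2 : ℝ) : 𝕜) := by
    rw [← inner_conj_symm, hrep g hg hgA, inner_self_eq_norm_sq_to_K]
    simp
  rw [borderedDet, patternMatrix_extGram_eq_fromBlocks H hf, ← hM]
  have hblock := Matrix.det_fromBlocks₂₂ (of fun _ _ => inner 𝕜 f f : Matrix Unit Unit 𝕜)
    (of fun _ (w : W) => starRingEnd 𝕜 (f (w : E))) col M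
  refine Eq.trans ?_ (hblock.trans ?_)
  · congr!
  · rw [hdetM, Matrix.mul_assoc, ← hself]
    congr 1
    rw [Matrix.det_unique (n := Unit), Matrix.sub_apply, Matrix.mul_apply, inner_sub_right, inner_sum]
    simp only [of_apply]
    congr 1
    refine Finset.sum_congr rfl fun w _ => ?_
    rw [inner_smul_right, inner_starProjection_unitVec_right hf, mul_comm]

end Hilbert

/-! ### Energy bounds and almost sure completeness. -/

section Completeness

open Matrix Filter
open scoped ComplexOrder

variable {𝕜 E : Type*} [RCLike 𝕜]

open Classical in
/-- The part of `S` lying in the finite set `W`. -/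
noncomputable def windowTrace (W : Finset E) (S : Set E) : Finset W :=
  Finset.univ.filter fun w : W => (w : E) ∈ S

theorem mem_windowTrace {W : Finset E} {S : Set E} {w : W} :
    w ∈ windowTrace W S ↔ (w : E) ∈ S := by
  simp [windowTrace]

theorem measurableSet_windowTrace_eq (W : Finset E) (A : Finset W) :
    MeasurableSet {S : Set E | windowTrace W S = A} := by
  have : {S : Set E | windowTrace W S = A} = ⋂ w : W, {S | (w : E) ∈ S ↔ w ∈ A} := by
    ext S
    simp [Finset.ext_iff, mem_windowTrace]
  rw [this]
  refine MeasurableSet.iInter fun w => ?_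
  by_cases hw : w ∈ A
  · simpa [hw] using measurableSet_mem (w : E)
  · simpa [hw] using measurableSet_notMem (w : E)

theorem IsDeterminantal.real_windowTrace_eq {H : ClosedSubmodule 𝕜 (ell2 𝕜 E)}
    {P : Measure (Set E)} (hP : IsDeterminantal (projMatrix H) P) (W : Finset E) (A : Finset W) :
    ((P.real {S : Set E | windowTrace W S = A} : ℝ) : 𝕜) = patternDet H W A := by
  classical
  have := hP.isProbabilityMeasure
  refine eq_of_sum_superset_eq (f := fun A => ((P.real {S | windowTrace W S = A} : ℝ) : 𝕜))
    (g := fun A => patternDet H W A) (fun C => ?_) A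
  have h1 : ∑ A : Finset W with C ⊆ A, P.real {S | windowTrace W S = A} =
      P.real {S | ((C.map (Function.Embedding.subtype (· ∈ W)) : Finset E) : Set E) ⊆ S} := by
    rw [← measureReal_biUnion_finset]
    · congr 1
      ext S
      simp only [Finset.mem_filter, Finset.mem_univ, true_and, Set.mem_iUnion, Set.mem_ofPred_eq,
        exists_prop, exists_eq_right']
      simp [Finset.subset_iff, Set.subset_def, mem_windowTrace]
    · intro A _ B _ hAB
      exact Set.disjoint_left.2 fun S hA hB => hAB (hA.symm.trans hB)
    · exact fun A _ => measurableSet_windowTrace_eq W A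
  rw [← RCLike.ofReal_sum, h1, hP.inclusion]
  refine Eq.trans ?_ ((det_submatrix_map_subtype (projMatrix H) C).trans ?_)
  · congr!
  · rw [← sum_det_patternMatrix]
    simp only [patternDet]

/-- The squared norm of the functional `v ↦ ⟪f, v⟫` on the vectors of `H` vanishing on `S ∩ W`, for
the norm of `ℓ²(E \ W)`. -/
noncomputable def tailEnergy (H : ClosedSubmodule 𝕜 (ell2 𝕜 E)) (f : ell2 𝕜 E) (W : Finset E)
    (A : Finset W) : ℝ :=
  RCLike.re (borderedDet H f W A) / RCLike.re (patternDet H W A)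

theorem sq_norm_inner_le_tailEnergy {H : ClosedSubmodule 𝕜 (ell2 𝕜 E)} {f : ell2 𝕜 E}
    (hf : f ∈ H.toSubmodule) {W : Finset E} {A : Finset W} (hA : patternDet H W A ≠ 0)
    {v : ell2 𝕜 E} (hv : v ∈ H.toSubmodule) (hvA : ∀ a ∈ A, v (a : E) = 0) :
    ‖inner 𝕜 v f‖ ^ 2 ≤ tailEnergy H f W A * ‖ellTail W v‖ ^ 2 := by
  obtain ⟨g, hg, hrep⟩ := exists_tail_representer H hf W A hA
  have hre : RCLike.re (patternDet H W A) ≠ 0 := fun h =>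
    hA (RCLike.ext (by simpa using h) (by simpa using (RCLike.nonneg_iff.1
      (patternDet_nonneg H W A)).2))
  have hE : tailEnergy H f W A = ‖ellTail W g‖ ^ 2 := by
    rw [tailEnergy, hg, RCLike.re_mul_ofReal, mul_div_cancel_left₀ _ hre]
  rw [hE, hrep v hv hvA, ← mul_pow, mul_comm]
  gcongr
  exact norm_inner_le_norm _ _

/-- The tail energy as a function of the random set. -/
noncomputable def randomTailEnergy (H : ClosedSubmodule 𝕜 (ell2 𝕜 E)) (f : ell2 𝕜 E)
    (W : Finset E) (S : Set E) : ENNReal :=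
  ENNReal.ofReal (tailEnergy H f W (windowTrace W S))

theorem randomTailEnergy_eq_sum (H : ClosedSubmodule 𝕜 (ell2 𝕜 E)) (f : ell2 𝕜 E)
    (W : Finset E) :
    randomTailEnergy H f W = fun S => ∑ A : Finset W, {S | windowTrace W S = A}.indicator
      (fun _ => ENNReal.ofReal (tailEnergy H f W A)) S := by
  classical
  ext S
  rw [Finset.sum_eq_single (windowTrace W S)]
  · rw [Set.indicator_of_mem (by simp)]
    rfl
  · intro B _ hB
    simp [Ne.symm hB]
  · simp

theorem measurable_randomTailEnergy (H : ClosedSubmodule 𝕜 (ell2 𝕜 E)) (f : ell2 𝕜 E)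
    (W : Finset E) : Measurable (randomTailEnergy H f W) := by
  rw [randomTailEnergy_eq_sum]
  exact Finset.measurable_sum _ fun A _ =>
    measurable_const.indicator (measurableSet_windowTrace_eq W A)

theorem IsDeterminantal.lintegral_randomTailEnergy_le {H : ClosedSubmodule 𝕜 (ell2 𝕜 E)}
    {P : Measure (Set E)} (hP : IsDeterminantal (projMatrix H) P) (f : ell2 𝕜 E) (W : Finset E) :
    ∫⁻ S, randomTailEnergy H f W S ∂P ≤ ENNReal.ofReal (‖f‖ ^ 2) := by
  have := hP.isProbabilityMeasure
  have hb : ∀ A, 0 ≤ RCLike.re (borderedDet H f W A) := fun A =>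
    (RCLike.nonneg_iff.1 (borderedDet_nonneg H f W A)).1
  have hp : ∀ A, 0 ≤ RCLike.re (patternDet H W A) := fun A =>
    (RCLike.nonneg_iff.1 (patternDet_nonneg H W A)).1
  have hsum : ∑ A, RCLike.re (borderedDet H f W A) = ‖f‖ ^ 2 := by
    rw [← map_sum, sum_borderedDet, RCLike.ofReal_re]
  rw [randomTailEnergy_eq_sum, lintegral_finsetSum _ fun A _ =>
    measurable_const.indicator (measurableSet_windowTrace_eq W A), ← hsum,
    ENNReal.ofReal_sum_of_nonneg fun A _ => hb A]
  refine Finset.sum_le_sum fun A _ => ?_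
  have hPA : P {S | windowTrace W S = A} = ENNReal.ofReal (RCLike.re (patternDet H W A)) := by
    rw [← hP.real_windowTrace_eq, RCLike.ofReal_re, ofReal_measureReal]
  rw [lintegral_indicator_const (measurableSet_windowTrace_eq W A), hPA, tailEnergy,
    ← ENNReal.ofReal_mul (div_nonneg (hb A) (hp A))]
  refine ENNReal.ofReal_le_ofReal ?_
  -- A null pattern contributes zero, possibly losing its bordered determinant; hence an inequality
  -- only.
  rcases eq_or_ne (RCLike.re (patternDet H W A)) 0 with h | h
  · rw [h, mul_zero]
    exact hb A
  · rw [div_mul_cancel₀ _ h]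

theorem IsDeterminantal.ae_patternDet_ne_zero {H : ClosedSubmodule 𝕜 (ell2 𝕜 E)}
    {P : Measure (Set E)} (hP : IsDeterminantal (projMatrix H) P) (W : Finset E) :
    ∀ᵐ S ∂P, patternDet H W (windowTrace W S) ≠ 0 := by
  have := hP.isProbabilityMeasure
  have h : ∀ A : Finset W, ∀ᵐ S ∂P, windowTrace W S = A → patternDet H W A ≠ 0 := by
    intro A
    by_cases hA : patternDet H W A = 0
    · have h0 : P {S | windowTrace W S = A} = 0 := by
        rw [← measureReal_eq_zero_iff]
        have := hP.real_windowTrace_eq W A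
        rw [hA] at this
        exact_mod_cast this
      filter_upwards [measure_eq_zero_iff_ae_notMem.1 h0] with S hS h
      exact absurd h hS
    · exact Eventually.of_forall fun _ _ => hA
  filter_upwards [ae_all_iff.2 h] with S hS
  exact hS _ rfl

/-- Almost surely, every vector of `H` vanishing on the random set is orthogonal to `f`. -/
theorem IsDeterminantal.ae_inner_eq_zero [Countable E] {H : ClosedSubmodule 𝕜 (ell2 𝕜 E)}
    {P : Measure (Set E)} (hP : IsDeterminantal (projMatrix H) P) {f : ell2 𝕜 E}
    (hf : f ∈ H.toSubmodule) :
    ∀ᵐ S ∂P, ∀ u ∈ H.toSubmodule, (∀ e ∈ S, u e = 0) → inner 𝕜 u f = 0 := by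
  obtain ⟨W, hW⟩ := exists_seq_tendsto (atTop : Filter (Finset E))
  have hlim : ∀ᵐ S ∂P, liminf (fun n => randomTailEnergy H f (W n) S) atTop < ⊤ := by
    refine ae_lt_top (Measurable.liminf fun n => measurable_randomTailEnergy H f (W n)) ?_
    refine ((lintegral_liminf_le fun n => measurable_randomTailEnergy H f (W n)).trans
      ?_).trans_lt (ENNReal.ofReal_lt_top (r := ‖f‖ ^ 2)) |>.ne
    exact liminf_le_of_le (by isBoundedDefault) fun b hb => by
      obtain ⟨n, hn⟩ := hb.exists
      exact hn.trans (hP.lintegral_randomTailEnergy_le f (W n))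
  filter_upwards [hlim, ae_all_iff.2 fun n => hP.ae_patternDet_ne_zero (W n)] with S hS hne u hu huS
  by_contra hinner
  set L := liminf (fun n => randomTailEnergy H f (W n) S) atTop with hL
  have hK : L < ENNReal.ofReal (L.toReal + 1) := by
    conv_lhs => rw [← ENNReal.ofReal_toReal hS.ne]
    exact (ENNReal.ofReal_lt_ofReal_iff (by positivity)).2 (by linarith)
  have hfreq := frequently_lt_of_liminf_lt (by isBoundedDefault) hK
  have htail : Tendsto (fun n => (L.toReal + 1) * ‖ellTail (W n) u‖ ^ 2) atTop (nhds 0) := by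
    have := (((tendsto_norm_ellTail u).comp hW).pow 2).const_mul (L.toReal + 1)
    simpa using this
  have hpos : 0 < ‖inner 𝕜 u f‖ ^ 2 := by positivity
  obtain ⟨n, hn1, hn2⟩ := (hfreq.and_eventually (htail.eventually_lt_const hpos)).exists
  have hlt : tailEnergy H f (W n) (windowTrace (W n) S) < L.toReal + 1 :=
    (ENNReal.ofReal_lt_ofReal_iff (by positivity)).1 hn1
  have hle := sq_norm_inner_le_tailEnergy hf (hne n) hu
    fun a ha => huS a (mem_windowTrace.1 ha)
  have : tailEnergy H f (W n) (windowTrace (W n) S) * ‖ellTail (W n) u‖ ^ 2 ≤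
      (L.toReal + 1) * ‖ellTail (W n) u‖ ^ 2 := by gcongr
  linarith

/-- For `u ∈ H`, orthogonality to `P_H e` means `u e = 0`, so the residual of projecting onto the
closed span vanishes on `S`. -/
theorem topologicalClosure_span_eq (H : ClosedSubmodule 𝕜 (ell2 𝕜 E)) {S : Set E}
    (hS : ∀ u ∈ H.toSubmodule, (∀ e ∈ S, u e = 0) → u = 0) :
    (Submodule.span 𝕜
      ((fun e : E => H.toSubmodule.starProjection (unitVec 𝕜 e)) '' S)).topologicalClosure =
      H.toSubmodule := by
  set K := Submodule.span 𝕜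
    ((fun e : E => H.toSubmodule.starProjection (unitVec 𝕜 e)) '' S) with hK
  have hle : K.topologicalClosure ≤ H.toSubmodule := by
    refine Submodule.topologicalClosure_minimal _ (Submodule.span_le.2 ?_) H.isClosed
    rintro _ ⟨e, -, rfl⟩
    exact Submodule.starProjection_apply_mem _ _
  refine le_antisymm hle fun h hh => ?_
  have : CompleteSpace K.topologicalClosure := K.isClosed_topologicalClosure.completeSpace_coe
  have hz := hS (h - K.topologicalClosure.starProjection h)
    (sub_mem hh (hle (Submodule.starProjection_apply_mem _ _))) fun e he => ?_
  · rw [sub_eq_zero.1 hz]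
    exact Submodule.starProjection_apply_mem _ _
  · rw [← inner_starProjection_unitVec_left (H := H)
      (sub_mem hh (hle (Submodule.starProjection_apply_mem _ _)))]
    exact Submodule.sub_starProjection_mem_orthogonal (K := K.topologicalClosure) h _
      (K.le_topologicalClosure (Submodule.subset_span ⟨e, he, rfl⟩))

end Completeness

theorem mainTheorem3 {𝕜 E : Type*} [RCLike 𝕜] [Countable E]
    (H : ClosedSubmodule 𝕜 (ell2 𝕜 E)) :
    (∃! P : Measure (Set E), IsDeterminantal (projMatrix H) P) ∧
      ∀ P : Measure (Set E), IsDeterminantal (projMatrix H) P →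
        ∀ᵐ S ∂P,
          (Submodule.span 𝕜
            ((fun e : E => H.toSubmodule.starProjection (unitVec 𝕜 e)) '' S)).topologicalClosure =
            H.toSubmodule := by
  constructor
  · obtain ⟨P, hP⟩ := exists_isDeterminantal (projMatrix H) fun W A => patternDet_nonneg H W A
    exact ⟨P, hP, fun P' hP' => hP'.unique hP⟩
  · intro P hP
    have h := ae_all_iff.2 fun e : E => hP.ae_inner_eq_zero
      (Submodule.starProjection_apply_mem H.toSubmodule (unitVec 𝕜 e))
    filter_upwards [h] with S hS
    refine topologicalClosure_span_eq H fun u hu huS => lp.ext (funext fun e => ?_)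
    have := hS e u hu huS
    rw [inner_starProjection_unitVec_right hu] at this
    simpa using this
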